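/- For positive functions write $f(\rho)\doteq g(\rho)$ if $\log f(\rho)/\log\rho$ and $\log g(\rho)/\log\rho$ converge to the same limit as $\rho\to\infty$, and $f(\rho)\mathrel{\dot\ge}\rho^{s}$ if $\liminf_{\rho\to\infty}\log f(\rho)/\log\rho\ge s$. Consider the two-user single-antenna Rayleigh-fading interference channel $$y_i=\sqrt{\rho}\,h_{ii}x_i+\sqrt{\rho^{\alpha}}\,h_{ji}x_j+z_i,\qquad \{i,j\}=\{1,2\},$$ with signal-to-noise ratio $\rho$ and very strong interference, $\alpha\ge 2$, where for each receiver $i$ the fading coefficients $h_{ii},h_{ji}$ and the noise $z_i$ are independent $\mathcal{CN}(0,1)$ random variables, independent of the transmitted symbols; receiver $i$ knows $h_{ii},h_{ji}$. Let $0\le r_1,r_2\le 1$. For every $\rho$, user $i$ transmits a symbol $x_i$ drawn uniformly (and independently of the other user) from a finite non-empty codebook $\mathcal X_i(\rho)\subset\{x\in\mathbb C:|x|^2\le 1\}$ of multiplexing rate $r_i$, i.e. $|\mathcal X_i(\rho)|\doteq\rho^{r_i}$; for all large $\rho$ at least one of the two codebooks has at least two elements. A stripping decoder at receiver $i$ first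 makes a maximum-likelihood (ML) decision $\bar x_j\in\mathcal X_j(\rho)$ on the interfering symbol, treating the intended signal as noise (either as Gaussian noise, so that the effective noise is $\mathcal{CN}(0,1+\rho|h_{ii}|^2)$, or as noise with its true law, induced by the uniform law of $x_i$ on $\mathcal X_i(\rho)$), then forms $y_i-\sqrt{\rho^\alpha}\,h_{ji}\bar x_j$, and finally makes an ML decision on $x_i$ from this signal as if the interference had been removed perfectly. Ties are broken in an arbitrary measurable way. Let $P(E_{ii})$ be the probability, averaged over symbols, noise and fading, that its output differs from $x_i$, and let $P(E)=\max\{P(E_{11}),P(E_{22})\}$. Suppose that for some $\epsilon\ge 0$ the minimum squared distances satisfy, for $i=1,2$, $$\min_{x\ne x'\in\mathcal X_i(\rho)}|x-x'|^2\mathrel{\dot\ge}\rho^{-r_i+\epsilon}$$ (the minimum over an empty set being $+\infty$). Then the stripping decoder achieves the diversity-multiplexing tradeoff outer bound: $$P(E)\doteq\rho^{-\min\{(1-r_1)^+,(1-r_2)^+\}}.$$ The same exponential equality holds when $P(E_{ii})$ is replaced by the error probability of the second stage under the assumption that the interference has been decoded correctly and removed. -/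

import Mathlib

open MeasureTheory Filter Topology

noncomputable section

namespace FadingIC

/-- Density (with respect to Lebesgue measure on `ℂ`) of the circularly symmetric complex
Gaussian law `𝒞𝒩(0, v)` of variance `v > 0`. -/
def cnDensity (v : ℝ) (z : ℂ) : ℝ :=
  (Real.pi * v)⁻¹ * Real.exp (-‖z‖ ^ 2 / v)

/-- The law `𝒞𝒩(0, 1)`. -/
def cn : Measure ℂ :=
  volume.withDensity fun z => ENNReal.ofReal (cnDensity 1 z)

/-- Exponential equality `f ≐ g`: for large `ρ` both functions are positive (so that the logarithms
are genuine), and `log f(ρ) / log ρ` and `log g(ρ) / log ρ` converge to one common limit. -/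
def ExpEq (f g : ℝ → ℝ) : Prop :=
  (∀ᶠ ρ in atTop, 0 < f ρ) ∧ (∀ᶠ ρ in atTop, 0 < g ρ) ∧
    ∃ c : ℝ, Tendsto (fun ρ => Real.log (f ρ) / Real.log ρ) atTop (𝓝 c) ∧
      Tendsto (fun ρ => Real.log (g ρ) / Real.log ρ) atTop (𝓝 c)

/-- A family of scalar codebooks, one for each SNR value `ρ`, of multiplexing rate `r` and subject
to the power constraint `|x|² ≤ 1`. The number of codewords is `ρ ^ r` to exponential order, since
`ρ ^ r` need not be an integer. -/
structure IsCodebookFamily (r : ℝ) (C : ℝ → Finset ℂ) : Prop where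
  nonempty : ∀ ρ, (C ρ).Nonempty
  power : ∀ ρ, ∀ x ∈ C ρ, ‖x‖ ^ 2 ≤ 1
  card : ExpEq (fun ρ => ((C ρ).card : ℝ)) (fun ρ => ρ ^ r)

/-- `|x - x'|² ≥̇ ρ ^ s` for every pair of distinct codewords, that is, the minimum squared
distance `d(ρ)` of the codebook has `liminf log d(ρ) / log ρ ≥ s`. -/
def MinDistExpGe (C : ℝ → Finset ℂ) (s : ℝ) : Prop :=
  ∀ δ > 0, ∀ᶠ ρ in atTop, ∀ x ∈ C ρ, ∀ x' ∈ C ρ, x ≠ x' → ρ ^ (s - δ) ≤ ‖x - x'‖ ^ 2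

/-- `x` is a maximum-likelihood decision from the codebook `C` for the likelihood function `L`. -/
def IsMLDecision (C : Finset ℂ) (L : ℂ → ℝ) (x : ℂ) : Prop :=
  x ∈ C ∧ ∀ x' ∈ C, L x' ≤ L x

/-- The two standard ways to treat the intended signal as noise: as Gaussian noise of the same
power, or as noise with its true law, the uniform law on the intended codebook. -/
inductive NoiseModel
  | gaussian
  | exact

/-- Likelihood of the interfering symbol `b` given the received signal `y`, when the intended signal
(codebook `A`) is treated as noise; `g` is the direct and `k` the cross fading coefficient. -/
def interfererLikelihood (ρ α : ℝ) (A : Finset ℂ) (g k y b : ℂ) : NoiseModel → ℝ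
  | .gaussian => cnDensity (1 + ρ * ‖g‖ ^ 2) (y - (√(ρ ^ α) : ℂ) * k * b)
  | .exact => (A.card : ℝ)⁻¹ *
      ∑ a ∈ A, cnDensity 1 (y - (√(ρ ^ α) : ℂ) * k * b - (√ρ : ℂ) * g * a)

/-- A stripping decoder at one receiver, with intended codebook `A` and interfering codebook `B`.
Both stages know the fading coefficients `g` (direct) and `k` (cross) that they use; ties in the ML
rules may be broken in any measurable way. -/
structure StrippingDecoder (m : NoiseModel) (ρ α : ℝ) (A B : Finset ℂ) where
  /-- First stage: `(g, k, y)` is mapped to the decoded interfering symbol. -/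
  interferer : ℂ × ℂ × ℂ → ℂ
  measurable_interferer : Measurable interferer
  interferer_ml : ∀ g k y,
    IsMLDecision B (fun b => interfererLikelihood ρ α A g k y b m) (interferer (g, k, y))
  /-- Second stage: `(g, y')` is mapped to the decoded intended symbol, where `y'` is the received
  signal after subtraction of the interference. -/
  intended : ℂ × ℂ → ℂ
  measurable_intended : Measurable intended
  intended_ml : ∀ g y',
    IsMLDecision A (fun a => cnDensity 1 (y' - (√ρ : ℂ) * g * a)) (intended (g, y'))

namespace StrippingDecoder

variable {m : NoiseModel} {ρ α : ℝ} {A B : Finset ℂ}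

/-- Output of the stripping decoder: decode the interference, subtract it, decode the intended
symbol. -/
def output (D : StrippingDecoder m ρ α A B) (g k y : ℂ) : ℂ :=
  D.intended (g, y - (√(ρ ^ α) : ℂ) * k * D.interferer (g, k, y))

/-- Error probability of the stripping decoder given the fading coefficients, for independent
uniformly distributed symbols `a`, `b` and noise `z ∼ 𝒞𝒩(0, 1)`; the received signal is
`√ρ g a + √(ρ ^ α) k b + z`. -/
def condError (D : StrippingDecoder m ρ α A B) (g k : ℂ) : ℝ :=
  ((A.card : ℝ) * B.card)⁻¹ * ∑ a ∈ A, ∑ b ∈ B,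
    cn.real {z | D.output g k ((√ρ : ℂ) * g * a + (√(ρ ^ α) : ℂ) * k * b + z) ≠ a}

/-- Error probability of the stripping decoder, averaged over independent `𝒞𝒩(0, 1)` fading. -/
def error (D : StrippingDecoder m ρ α A B) : ℝ :=
  ∫ h : ℂ × ℂ, D.condError h.1 h.2 ∂(cn.prod cn)

/-- Average error probability of the second stage when the interference has been decoded correctly
and removed, so that its input is `√ρ g a + z`. -/
def errorNoInterference (D : StrippingDecoder m ρ α A B) : ℝ :=
  ∫ g : ℂ, (A.card : ℝ)⁻¹ * ∑ a ∈ A,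
    cn.real {z | D.intended (g, (√ρ : ℂ) * g * a + z) ≠ a} ∂cn

end StrippingDecoder

end FadingIC

end

open FadingIC

/-!
A minimum-distance decision is wrong only if the noise exceeds half of the scaled distance. For the
second stage, on a codebook of minimum squared distance `Δ`, this has conditional probability at
most `2 exp (-ρ Δ |g|² / 8)`, hence at most `16 / (ρ Δ)` after averaging over the fading. For
`Δ ≈ ρ ^ (-r)` this is `ρ ^ (-(1 - r))`. Similarly, under either noise model, a wrong decision on
the interferer forces `ρ ^ α Δ' |k|² ≲ ρ (|g|² + |z|² + 1)`, which has probability of order at most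
`1 / (ρ ^ (α - 1) Δ')`. For `Δ' ≈ ρ ^ (-r')` this is `ρ ^ (-(α - 1 - r'))`, and
`α - 1 - r' ≥ 1 - r'` because `α ≥ 2`.

Conversely, take the larger of the two codebooks, with `N ≥ 2` points. With probability of order
`min 1 (N / ρ)` its direct link satisfies `ρ |g|² ≤ N / 400`. Then the `N` noiseless received points
lie in a disc whose area is a small multiple of `N`, so by a volume argument no decoder has an error
probability below `1 / 50`.
-/

namespace FadingIC

open scoped BigOperators

/-! ### The complex Gaussian law -/

theorem cnDensity_nonneg {v : ℝ} (hv : 0 ≤ v) (z : ℂ) : 0 ≤ cnDensity v z := by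
  unfold cnDensity
  positivity

theorem continuous_cnDensity (v : ℝ) : Continuous (cnDensity v) := by
  unfold cnDensity
  fun_prop

theorem norm_le_norm_of_cnDensity_le {v : ℝ} (hv : 0 < v) {z w : ℂ}
    (h : cnDensity v z ≤ cnDensity v w) : ‖w‖ ≤ ‖z‖ := by
  have hexp := le_of_mul_le_mul_left h (by positivity : 0 < (Real.pi * v)⁻¹)
  rw [Real.exp_le_exp, div_le_div_iff_of_pos_right hv, neg_le_neg_iff] at hexp
  exact (sq_le_sq₀ (norm_nonneg _) (norm_nonneg _)).1 hexp

theorem sq_norm_le_add_log_of_cnDensity_le_mul {c : ℝ} (hc : 0 < c) {z w : ℂ}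
    (h : cnDensity 1 z ≤ c * cnDensity 1 w) : ‖w‖ ^ 2 ≤ ‖z‖ ^ 2 + Real.log c := by
  unfold cnDensity at h
  rw [mul_left_comm] at h
  have hlog := Real.log_le_log (Real.exp_pos _) (le_of_mul_le_mul_left h (by positivity))
  rw [Real.log_mul hc.ne' (Real.exp_pos _).ne', Real.log_exp, Real.log_exp, div_one,
    div_one] at hlog
  linarith

theorem mgf_sq_norm_cn {t : ℝ} (ht : t < 1) :
    ProbabilityTheory.mgf (fun z : ℂ => ‖z‖ ^ 2) cn t = (1 - t)⁻¹ := by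
  have hpos : 0 < 1 - t := by linarith
  have hdensity (z : ℂ) : cnDensity 1 z * Real.exp (t * ‖z‖ ^ 2) =
      Real.pi⁻¹ * Real.exp (-(1 - t) * ‖z‖ ^ 2) := by
    rw [cnDensity, mul_assoc, ← Real.exp_add]
    ring_nf
  rw [ProbabilityTheory.mgf, cn, integral_withDensity_eq_integral_toReal_smul
    (continuous_cnDensity 1).measurable.ennreal_ofReal (by simp)]
  simp only [ENNReal.toReal_ofReal (cnDensity_nonneg zero_le_one _), smul_eq_mul, hdensity]
  rw [integral_const_mul, GaussianFourier.integral_rexp_neg_mul_sq_norm hpos,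
    Complex.finrank_real_complex, Nat.cast_ofNat, div_self two_ne_zero, Real.rpow_one]
  field_simp

instance isProbabilityMeasure_cn : IsProbabilityMeasure cn := by
  have h := mgf_sq_norm_cn zero_lt_one
  simp only [ProbabilityTheory.mgf, zero_mul, Real.exp_zero, integral_const, smul_eq_mul, mul_one,
    sub_zero, inv_one] at h
  exact isProbabilityMeasure_iff_real.2 h

theorem integrable_exp_mul_sq_norm_cn {t : ℝ} (ht : t < 1) :
    Integrable (fun z : ℂ => Real.exp (t * ‖z‖ ^ 2)) cn := by
  rw [← ProbabilityTheory.mgf_pos_iff, mgf_sq_norm_cn ht]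
  exact inv_pos.2 (by linarith)

theorem integral_exp_neg_mul_sq_norm_cn_le {c : ℝ} (hc : 0 < c) :
    ∫ z, Real.exp (-c * ‖z‖ ^ 2) ∂cn ≤ c⁻¹ := by
  calc ∫ z, Real.exp (-c * ‖z‖ ^ 2) ∂cn = (1 - -c)⁻¹ := mgf_sq_norm_cn (by linarith)
    _ ≤ c⁻¹ := inv_anti₀ hc (by linarith)

theorem cn_real_setOf_le_sq_norm_le (r : ℝ) :
    cn.real {z | r ≤ ‖z‖ ^ 2} ≤ 2 * Real.exp (-(r / 2)) := by
  have hchernoff := ProbabilityTheory.measure_ge_le_exp_mul_mgf r (by norm_num)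
    (integrable_exp_mul_sq_norm_cn one_half_lt_one)
  rw [mgf_sq_norm_cn one_half_lt_one] at hchernoff
  convert hchernoff using 1
  ring_nf

theorem cn_le_smul_volume : cn ≤ ENNReal.ofReal Real.pi⁻¹ • volume := by
  rw [cn, ← withDensity_const]
  refine withDensity_mono (Eventually.of_forall fun z => ENNReal.ofReal_le_ofReal ?_)
  rw [cnDensity, mul_one]
  refine mul_le_of_le_one_right (by positivity) (Real.exp_le_one_iff.2 ?_)
  rw [div_one]
  exact neg_nonpos.2 (sq_nonneg _)

theorem ofReal_mul_volume_closedBall {c r : ℝ} (hc : 0 ≤ c) (hr : 0 ≤ r) (a : ℂ) :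
    ENNReal.ofReal (Real.pi⁻¹ * c) * volume (Metric.closedBall a r) =
      ENNReal.ofReal (r ^ 2 * c) := by
  rw [Complex.volume_closedBall, ← ENNReal.ofReal_pow hr, ← ENNReal.ofReal_coe_nnreal,
    NNReal.coe_real_pi, ← ENNReal.ofReal_mul (by positivity), ← ENNReal.ofReal_mul (by positivity)]
  congr 1
  field_simp

theorem le_cn_real_closedBall {r : ℝ} (hr : 0 ≤ r) (hr1 : r ≤ 1) :
    r ^ 2 * (1 - r ^ 2) ≤ cn.real (Metric.closedBall 0 r) := by
  have hc : 0 ≤ 1 - r ^ 2 := sub_nonneg.2 (pow_le_one₀ hr hr1)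
  have hdensity : ∀ z ∈ Metric.closedBall (0 : ℂ) r, Real.pi⁻¹ * (1 - r ^ 2) ≤ cnDensity 1 z := by
    intro z hz
    have hz : ‖z‖ ^ 2 ≤ r ^ 2 := pow_le_pow_left₀ (norm_nonneg z) (mem_closedBall_zero_iff.1 hz) 2
    rw [cnDensity, mul_one, div_one]
    gcongr
    linarith [Real.one_sub_le_exp_neg (‖z‖ ^ 2)]
  rw [measureReal_def, ← ENNReal.ofReal_le_iff_le_toReal (measure_ne_top _ _)]
  calc ENNReal.ofReal (r ^ 2 * (1 - r ^ 2))
      = ∫⁻ _ in Metric.closedBall (0 : ℂ) r, ENNReal.ofReal (Real.pi⁻¹ * (1 - r ^ 2)) := by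
        rw [setLIntegral_const, ofReal_mul_volume_closedBall hc hr]
    _ ≤ ∫⁻ z in Metric.closedBall (0 : ℂ) r, ENNReal.ofReal (cnDensity 1 z) :=
        setLIntegral_mono' Metric.isClosed_closedBall.measurableSet fun z hz =>
          ENNReal.ofReal_le_ofReal (hdensity z hz)
    _ ≤ cn (Metric.closedBall 0 r) := withDensity_apply_le _ _

theorem mul_le_integral_cn_of_le_on_fade {f : ℂ → ℝ} (hf : Integrable f cn) (hf₀ : ∀ g, 0 ≤ f g)
    {c t : ℝ} (hc : 0 ≤ c) (ht : 0 ≤ t) (ht' : t ≤ 1 / 2) (h : ∀ g, ‖g‖ ^ 2 ≤ t → c ≤ f g) :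
    c * (t / 2) ≤ ∫ g, f g ∂cn := by
  have hfade : t / 2 ≤ cn.real (Metric.closedBall 0 √t) := by
    have := le_cn_real_closedBall (Real.sqrt_nonneg t) (Real.sqrt_le_one.2 (by linarith))
    rw [Real.sq_sqrt ht] at this
    nlinarith
  have hsub : Metric.closedBall 0 √t ⊆ {g | c ≤ f g} := fun g hg =>
    h g ((Real.le_sqrt (norm_nonneg g) ht).1 (mem_closedBall_zero_iff.1 hg))
  calc c * (t / 2) ≤ c * cn.real {g | c ≤ f g} := by
        gcongr
        exact hfade.trans (measureReal_mono hsub)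
    _ ≤ ∫ g, f g ∂cn := mul_meas_ge_le_integral_of_nonneg (Eventually.of_forall hf₀) hf c

/-! ### Decoding a single symbol over a known channel -/

/-- Average error probability of the decoder `φ` for a symbol drawn uniformly from the codebook `A`
and received as `s * a + z`, with known gain `s` and noise `z ∼ 𝒞𝒩(0, 1)`. It is the common form
of the conditional error probabilities of both stages. -/
noncomputable def symbolError (A : Finset ℂ) (s : ℂ) (φ : ℂ → ℂ) : ℝ :=
  𝔼 a ∈ A, cn.real {z | φ (s * a + z) ≠ a}

theorem symbolError_nonneg (A : Finset ℂ) (s : ℂ) (φ : ℂ → ℂ) : 0 ≤ symbolError A s φ :=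
  Finset.expect_nonneg fun _ _ => measureReal_nonneg

theorem symbolError_le_one {A : Finset ℂ} (hA : A.Nonempty) (s : ℂ) (φ : ℂ → ℂ) :
    symbolError A s φ ≤ 1 :=
  Finset.expect_le hA fun _ _ => measureReal_le_one

theorem measurable_symbolError {X : Type*} [MeasurableSpace X] (A : Finset ℂ) {s : X → ℂ}
    (hs : Measurable s) {φ : X → ℂ → ℂ} (hφ : Measurable fun p : X × ℂ => φ p.1 p.2) :
    Measurable fun x => symbolError A (s x) (φ x) := by
  simp only [symbolError, Finset.expect_eq_sum_div_card]
  refine (Finset.measurable_fun_sum _ fun a _ => ?_).div_const _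
  have hset : MeasurableSet {p : X × ℂ | φ p.1 (s p.1 * a + p.2) ≠ a} :=
    (hφ.comp (f := fun p : X × ℂ => (p.1, s p.1 * a + p.2)) (by fun_prop)
      (measurableSet_singleton a)).compl
  exact (measurable_measure_prodMk_left (ν := cn) hset).ennreal_toReal

theorem symbolError_le_add {A : Finset ℂ} (hA₀ : A.Nonempty) {s : ℂ} {φ ψ : ℂ → ℂ} {q : ℝ}
    (h : ∀ a ∈ A, cn.real {z | φ (s * a + z) ≠ ψ (s * a + z)} ≤ q) :
    symbolError A s φ ≤ symbolError A s ψ + q := by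
  have hterm : ∀ a ∈ A, cn.real {z | φ (s * a + z) ≠ a} ≤ cn.real {z | ψ (s * a + z) ≠ a} + q := by
    intro a ha
    calc cn.real {z | φ (s * a + z) ≠ a}
        ≤ cn.real ({z | ψ (s * a + z) ≠ a} ∪ {z | φ (s * a + z) ≠ ψ (s * a + z)}) := by
          refine measureReal_mono fun z hz => ?_
          by_cases hdec : φ (s * a + z) = ψ (s * a + z)
          · exact Or.inl fun hψ => hz (hdec.trans hψ)
          · exact Or.inr hdec
      _ ≤ cn.real {z | ψ (s * a + z) ≠ a} + q :=
          (measureReal_union_le _ _).trans (by gcongr; exact h a ha)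
  calc symbolError A s φ ≤ 𝔼 a ∈ A, (cn.real {z | ψ (s * a + z) ≠ a} + q) :=
        Finset.expect_le_expect hterm
    _ = symbolError A s ψ + q := by
        rw [Finset.expect_add_distrib, Finset.expect_const hA₀, symbolError]

theorem sum_cn_real_closedBall_inter_le {A : Finset ℂ} (hA : ∀ a ∈ A, ‖a‖ ≤ 1) (s : ℂ)
    {φ : ℂ → ℂ} (hφ : Measurable φ) {R : ℝ} (hR : 0 ≤ R) :
    ∑ a ∈ A, cn.real (Metric.closedBall 0 R ∩ {z | φ (s * a + z) = a}) ≤ (‖s‖ + R) ^ 2 := by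
  set K := Metric.closedBall (0 : ℂ) (‖s‖ + R)
  have htranslate : ∀ a ∈ A, cn (Metric.closedBall 0 R ∩ {z | φ (s * a + z) = a}) ≤
      ENNReal.ofReal Real.pi⁻¹ * volume.restrict K (φ ⁻¹' {a}) := by
    intro a ha
    have hball : ∀ z ∈ Metric.closedBall (0 : ℂ) R, s * a + z ∈ K := by
      intro z hz
      rw [mem_closedBall_zero_iff] at hz ⊢
      calc ‖s * a + z‖ ≤ ‖s‖ * ‖a‖ + ‖z‖ := (norm_add_le _ _).trans_eq (by rw [norm_mul])
        _ ≤ ‖s‖ + R := add_le_add (mul_le_of_le_one_right (norm_nonneg s) (hA a ha)) hz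
    calc cn (Metric.closedBall 0 R ∩ {z | φ (s * a + z) = a})
        ≤ ENNReal.ofReal Real.pi⁻¹ *
            volume (Metric.closedBall 0 R ∩ {z | φ (s * a + z) = a}) := cn_le_smul_volume _
      _ ≤ ENNReal.ofReal Real.pi⁻¹ * volume ((s * a + ·) ⁻¹' (φ ⁻¹' {a} ∩ K)) := by
        gcongr
        exact fun z hz => ⟨hz.2, hball z hz.1⟩
      _ = ENNReal.ofReal Real.pi⁻¹ * volume.restrict K (φ ⁻¹' {a}) := by
        rw [measure_preimage_add, Measure.restrict_apply (hφ (measurableSet_singleton a))]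
  have hsum : ∑ a ∈ A, cn (Metric.closedBall 0 R ∩ {z | φ (s * a + z) = a}) ≤
      ENNReal.ofReal ((‖s‖ + R) ^ 2) := by
    calc ∑ a ∈ A, cn (Metric.closedBall 0 R ∩ {z | φ (s * a + z) = a})
        ≤ ENNReal.ofReal Real.pi⁻¹ * ∑ a ∈ A, volume.restrict K (φ ⁻¹' {a}) := by
          rw [Finset.mul_sum]
          exact Finset.sum_le_sum htranslate
      _ = ENNReal.ofReal Real.pi⁻¹ * volume.restrict K (φ ⁻¹' A) := by
          rw [sum_measure_preimage_singleton A fun a _ => hφ (measurableSet_singleton a)]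
      _ ≤ ENNReal.ofReal (Real.pi⁻¹ * 1) * volume K := by
          rw [mul_one, ← Measure.restrict_apply_univ K]
          gcongr
          exact Set.subset_univ _
      _ = ENNReal.ofReal ((‖s‖ + R) ^ 2) := by
          rw [ofReal_mul_volume_closedBall zero_le_one (by positivity), mul_one]
  simp only [measureReal_def]
  rw [← ENNReal.toReal_sum fun a _ => measure_ne_top _ _]
  exact ENNReal.toReal_le_of_le_ofReal (by positivity) hsum

theorem sub_div_card_le_symbolError {A : Finset ℂ} (hA₀ : A.Nonempty) (hA : ∀ a ∈ A, ‖a‖ ≤ 1)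
    (s : ℂ) {φ : ℂ → ℂ} (hφ : Measurable φ) {R : ℝ} (hR : 0 ≤ R) :
    cn.real (Metric.closedBall 0 R) - (‖s‖ + R) ^ 2 / A.card ≤ symbolError A s φ := by
  have hterm (a : ℂ) : cn.real (Metric.closedBall 0 R) ≤ cn.real {z | φ (s * a + z) ≠ a} +
      cn.real (Metric.closedBall 0 R ∩ {z | φ (s * a + z) = a}) := by
    refine (measureReal_mono fun z hz => ?_).trans (measureReal_union_le _ _)
    by_cases hdec : φ (s * a + z) = a
    · exact Or.inr ⟨hz, hdec⟩
    · exact Or.inl hdec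
  rw [sub_le_iff_le_add]
  calc cn.real (Metric.closedBall 0 R)
      ≤ 𝔼 a ∈ A, (cn.real {z | φ (s * a + z) ≠ a} +
          cn.real (Metric.closedBall 0 R ∩ {z | φ (s * a + z) = a})) :=
        Finset.le_expect hA₀ fun a _ => hterm a
    _ ≤ symbolError A s φ + (‖s‖ + R) ^ 2 / A.card := by
        rw [Finset.expect_add_distrib, ← symbolError, Finset.expect_eq_sum_div_card]
        gcongr
        exact sum_cn_real_closedBall_inter_le hA s hφ hR

theorem one_div_fifty_le_symbolError {A : Finset ℂ} (hA : ∀ a ∈ A, ‖a‖ ≤ 1) (hcard : 2 ≤ A.card)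
    {s : ℂ} (hs : ‖s‖ ^ 2 ≤ A.card / 400) {φ : ℂ → ℂ} (hφ : Measurable φ) :
    1 / 50 ≤ symbolError A s φ := by
  have hN : (2 : ℝ) ≤ A.card := by exact_mod_cast hcard
  have hA₀ : A.Nonempty := Finset.card_pos.1 (by omega)
  have hball : 3 / 16 ≤ cn.real (Metric.closedBall 0 (1 / 2)) :=
    le_trans (by norm_num) (le_cn_real_closedBall (r := 1 / 2) (by norm_num) (by norm_num))
  have harea : (‖s‖ + 1 / 2) ^ 2 / A.card ≤ 33 / 200 := by
    rw [div_le_iff₀ (by linarith)]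
    nlinarith [sq_nonneg (‖s‖ - 1 / 10)]
  linarith [sub_div_card_le_symbolError hA₀ hA s hφ (R := 1 / 2) (by norm_num)]

theorem min_one_div_le_integral_cn {f : ℂ → ℝ} (hf : Integrable f cn) (hf₀ : ∀ g, 0 ≤ f g)
    {N ρ : ℝ} (hρ : 0 < ρ) (hN : 0 ≤ N) (h : ∀ g, ρ * ‖g‖ ^ 2 ≤ N / 400 → 1 / 50 ≤ f g) :
    min 1 (N / ρ) / 40000 ≤ ∫ g, f g ∂cn := by
  calc min 1 (N / ρ) / 40000 = 1 / 50 * (min 1 (N / ρ) / 400 / 2) := by ring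
    _ ≤ ∫ g, f g ∂cn := by
      refine mul_le_integral_cn_of_le_on_fade hf hf₀ (by norm_num) (by positivity)
        (by linarith [min_le_left 1 (N / ρ)]) fun g hg => h g ?_
      calc ρ * ‖g‖ ^ 2 ≤ ρ * (N / ρ / 400) := by
            gcongr
            linarith [min_le_right 1 (N / ρ)]
        _ = N / 400 := by field_simp

/-! ### Maximum-likelihood decisions -/

namespace IsMLDecision

theorem norm_mul_sub_le {v : ℝ} (hv : 0 < v) {C : Finset ℂ} {c y x b : ℂ}
    (hx : IsMLDecision C (fun b' => cnDensity v (y - c * b')) x) (hb : b ∈ C) :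
    ‖c * (b - x)‖ ≤ 2 * ‖y - c * b‖ := by
  have hcloser : ‖y - c * x‖ ≤ ‖y - c * b‖ := norm_le_norm_of_cnDensity_le hv (hx.2 b hb)
  calc ‖c * (b - x)‖ = ‖(y - c * x) - (y - c * b)‖ := by ring_nf
    _ ≤ ‖y - c * x‖ + ‖y - c * b‖ := norm_sub_le _ _
    _ ≤ 2 * ‖y - c * b‖ := by linarith

theorem exists_sq_norm_sub_le {A B : Finset ℂ} {y c s x a b : ℂ}
    (hx : IsMLDecision B
      (fun b' => (A.card : ℝ)⁻¹ * ∑ a' ∈ A, cnDensity 1 (y - c * b' - s * a')) x)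
    (ha : a ∈ A) (hb : b ∈ B) :
    ∃ a' ∈ A, ‖y - c * x - s * a'‖ ^ 2 ≤ ‖y - c * b - s * a‖ ^ 2 + Real.log A.card := by
  have hA₀ : A.Nonempty := ⟨a, ha⟩
  have hN : (0 : ℝ) < A.card := by exact_mod_cast hA₀.card_pos
  have hsum : ∑ _ ∈ A, cnDensity 1 (y - c * b - s * a) / A.card ≤
      ∑ a' ∈ A, cnDensity 1 (y - c * x - s * a') := by
    calc ∑ _ ∈ A, cnDensity 1 (y - c * b - s * a) / A.card
        = cnDensity 1 (y - c * b - s * a) := by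
          rw [Finset.sum_const, nsmul_eq_mul, mul_div_cancel₀ _ hN.ne']
      _ ≤ ∑ a' ∈ A, cnDensity 1 (y - c * b - s * a') :=
          Finset.single_le_sum (f := fun a' => cnDensity 1 (y - c * b - s * a'))
            (fun _ _ => cnDensity_nonneg zero_le_one _) ha
      _ ≤ ∑ a' ∈ A, cnDensity 1 (y - c * x - s * a') :=
          le_of_mul_le_mul_left (hx.2 b hb) (inv_pos.2 hN)
  obtain ⟨a', ha', hle⟩ := Finset.exists_le_of_sum_le hA₀ hsum
  exact ⟨a', ha', sq_norm_le_add_log_of_cnDensity_le_mul hN ((div_le_iff₀' hN).1 hle)⟩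

variable {ρ α : ℝ} {A B : Finset ℂ} {g k a b z x : ℂ}

theorem norm_mul_sub_le_of_gaussian (hρ : 0 ≤ ρ) (hA : ∀ a ∈ A, ‖a‖ ≤ 1) (ha : a ∈ A) (hb : b ∈ B)
    (hx : IsMLDecision B (fun b' => interfererLikelihood ρ α A g k
      ((√ρ : ℂ) * g * a + (√(ρ ^ α) : ℂ) * k * b + z) b' .gaussian) x) :
    ‖(√(ρ ^ α) : ℂ) * k * (b - x)‖ ≤ 2 * (‖(√ρ : ℂ) * g‖ + ‖z‖) := by
  have h := norm_mul_sub_le (by positivity) hx hb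
  rw [add_right_comm, add_sub_cancel_right] at h
  calc _ ≤ 2 * ‖(√ρ : ℂ) * g * a + z‖ := h
    _ ≤ 2 * (‖(√ρ : ℂ) * g‖ * ‖a‖ + ‖z‖) := by
      rw [← norm_mul]
      gcongr
      exact norm_add_le _ _
    _ ≤ 2 * (‖(√ρ : ℂ) * g‖ + ‖z‖) := by
      gcongr
      exact mul_le_of_le_one_right (norm_nonneg _) (hA a ha)

theorem exists_norm_mul_sub_le_of_exact (hA : ∀ a ∈ A, ‖a‖ ≤ 1) (ha : a ∈ A) (hb : b ∈ B)
    (hx : IsMLDecision B (fun b' => interfererLikelihood ρ α A g k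
      ((√ρ : ℂ) * g * a + (√(ρ ^ α) : ℂ) * k * b + z) b' .exact) x) :
    ∃ v : ℝ, v ^ 2 ≤ ‖z‖ ^ 2 + Real.log A.card ∧
      ‖(√(ρ ^ α) : ℂ) * k * (b - x)‖ ≤ v + 2 * ‖(√ρ : ℂ) * g‖ + ‖z‖ := by
  obtain ⟨a', ha', hle⟩ := exists_sq_norm_sub_le hx ha hb
  rw [add_right_comm, add_sub_cancel_right, add_sub_cancel_left] at hle
  refine ⟨_, hle, ?_⟩
  set s := (√ρ : ℂ) * g
  set c := (√(ρ ^ α) : ℂ) * k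
  have hdiff : ‖s * (a' - a)‖ ≤ 2 * ‖s‖ := by
    rw [norm_mul, mul_comm]
    gcongr
    linarith [norm_sub_le a' a, hA a ha, hA a' ha']
  calc ‖c * (b - x)‖ = ‖(s * a + z + c * b - c * x - s * a') + s * (a' - a) - z‖ := by ring_nf
    _ ≤ ‖s * a + z + c * b - c * x - s * a'‖ + ‖s * (a' - a)‖ + ‖z‖ :=
      (norm_sub_le _ _).trans (by gcongr; exact norm_add_le _ _)
    _ ≤ ‖s * a + z + c * b - c * x - s * a'‖ + 2 * ‖s‖ + ‖z‖ := by gcongr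

theorem sq_norm_mul_sub_le {m : NoiseModel} (hρ : 0 ≤ ρ) (hA : ∀ a ∈ A, ‖a‖ ≤ 1) (ha : a ∈ A)
    (hb : b ∈ B) (hx : IsMLDecision B (fun b' => interfererLikelihood ρ α A g k
      ((√ρ : ℂ) * g * a + (√(ρ ^ α) : ℂ) * k * b + z) b' m) x) :
    ‖(√(ρ ^ α) : ℂ) * k * (b - x)‖ ^ 2 ≤
      12 * (‖(√ρ : ℂ) * g‖ ^ 2 + ‖z‖ ^ 2 + Real.log A.card) := by
  cases m with
  | gaussian =>
    have h := pow_le_pow_left₀ (norm_nonneg _) (norm_mul_sub_le_of_gaussian hρ hA ha hb hx) 2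
    nlinarith [sq_nonneg (‖(√ρ : ℂ) * g‖ - ‖z‖), sq_nonneg ‖(√ρ : ℂ) * g‖, sq_nonneg ‖z‖,
      Real.log_natCast_nonneg A.card]
  | exact =>
    obtain ⟨v, hv, hle⟩ := exists_norm_mul_sub_le_of_exact hA ha hb hx
    have h := pow_le_pow_left₀ (norm_nonneg _) hle 2
    have hcauchy (u w : ℝ) : (v + 2 * u + w) ^ 2 ≤ 6 * (v ^ 2 + u ^ 2 + w ^ 2) := by
      nlinarith [sq_nonneg (2 * v - u), sq_nonneg (v - w), sq_nonneg (u - 2 * w)]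
    linarith [hcauchy ‖(√ρ : ℂ) * g‖ ‖z‖, sq_nonneg ‖(√ρ : ℂ) * g‖, Real.log_natCast_nonneg A.card]

end IsMLDecision

/-! ### The stripping decoder at fixed signal-to-noise ratio -/

theorem norm_sqrt_mul_sq {ρ : ℝ} (hρ : 0 ≤ ρ) (g : ℂ) : ‖(√ρ : ℂ) * g‖ ^ 2 = ρ * ‖g‖ ^ 2 := by
  rw [norm_mul, mul_pow, Complex.norm_real, Real.norm_eq_abs, sq_abs, Real.sq_sqrt hρ]

namespace StrippingDecoder

variable {m : NoiseModel} {ρ α : ℝ} {A B : Finset ℂ}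

theorem nonempty_intended (D : StrippingDecoder m ρ α A B) : A.Nonempty :=
  ⟨_, (D.intended_ml 0 0).1⟩

theorem nonempty_interferer (D : StrippingDecoder m ρ α A B) : B.Nonempty :=
  ⟨_, (D.interferer_ml 0 0 0).1⟩

theorem measurable_output (D : StrippingDecoder m ρ α A B) :
    Measurable fun p : ℂ × ℂ × ℂ => D.output p.1 p.2.1 p.2.2 := by
  have := D.measurable_interferer
  exact D.measurable_intended.comp (by fun_prop)

/-- Error probability of the second stage given the direct fading coefficient, when the interference
has been decoded correctly and removed; the integrand of `errorNoInterference`. -/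
noncomputable def condErrorNoInterference (D : StrippingDecoder m ρ α A B) (g : ℂ) : ℝ :=
  symbolError A ((√ρ : ℂ) * g) fun y => D.intended (g, y)

theorem errorNoInterference_eq_integral (D : StrippingDecoder m ρ α A B) :
    D.errorNoInterference = ∫ g, D.condErrorNoInterference g ∂cn := by
  simp only [errorNoInterference, condErrorNoInterference, symbolError,
    Finset.expect_eq_sum_div_card, div_eq_inv_mul]

theorem condError_eq_expect (D : StrippingDecoder m ρ α A B) (g k : ℂ) :
    D.condError g k = 𝔼 b ∈ B,
      symbolError A ((√ρ : ℂ) * g) fun y => D.output g k (y + (√(ρ ^ α) : ℂ) * k * b) := by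
  simp only [condError, symbolError, Finset.expect_eq_sum_div_card]
  rw [Finset.sum_comm, ← Finset.sum_div, div_div, ← div_eq_inv_mul]
  simp only [add_right_comm]

theorem measurable_condErrorNoInterference (D : StrippingDecoder m ρ α A B) :
    Measurable D.condErrorNoInterference :=
  measurable_symbolError A (by fun_prop) D.measurable_intended

theorem measurable_condError (D : StrippingDecoder m ρ α A B) :
    Measurable fun h : ℂ × ℂ => D.condError h.1 h.2 := by
  simp only [condError_eq_expect, Finset.expect_eq_sum_div_card]
  refine (Finset.measurable_fun_sum _ fun b _ => ?_).div_const _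
  refine measurable_symbolError A (X := ℂ × ℂ) (by fun_prop) ?_
  exact D.measurable_output.comp (f := fun p : (ℂ × ℂ) × ℂ =>
    (p.1.1, p.1.2, p.2 + (√(ρ ^ α) : ℂ) * p.1.2 * b)) (by fun_prop)

theorem condErrorNoInterference_nonneg (D : StrippingDecoder m ρ α A B) (g : ℂ) :
    0 ≤ D.condErrorNoInterference g :=
  symbolError_nonneg _ _ _

theorem condErrorNoInterference_le_one (D : StrippingDecoder m ρ α A B) (g : ℂ) :
    D.condErrorNoInterference g ≤ 1 :=
  symbolError_le_one D.nonempty_intended _ _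

theorem condError_nonneg (D : StrippingDecoder m ρ α A B) (g k : ℂ) : 0 ≤ D.condError g k := by
  rw [condError_eq_expect]
  exact Finset.expect_nonneg fun _ _ => symbolError_nonneg _ _ _

theorem condError_le_one (D : StrippingDecoder m ρ α A B) (g k : ℂ) : D.condError g k ≤ 1 := by
  rw [condError_eq_expect]
  exact Finset.expect_le D.nonempty_interferer fun _ _ => symbolError_le_one D.nonempty_intended _ _

theorem integrable_condErrorNoInterference (D : StrippingDecoder m ρ α A B) :
    Integrable D.condErrorNoInterference cn :=
  .of_bound D.measurable_condErrorNoInterference.aestronglyMeasurable 1 <|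
    Eventually.of_forall fun g => by
      rw [Real.norm_of_nonneg (D.condErrorNoInterference_nonneg g)]
      exact D.condErrorNoInterference_le_one g

theorem integrable_condError (D : StrippingDecoder m ρ α A B) :
    Integrable (fun h : ℂ × ℂ => D.condError h.1 h.2) (cn.prod cn) :=
  .of_bound D.measurable_condError.aestronglyMeasurable 1 <|
    Eventually.of_forall fun h => by
      rw [Real.norm_of_nonneg (D.condError_nonneg _ _)]
      exact D.condError_le_one _ _

theorem errorNoInterference_le_one (D : StrippingDecoder m ρ α A B) :
    D.errorNoInterference ≤ 1 := by
  rw [errorNoInterference_eq_integral]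
  calc ∫ g, D.condErrorNoInterference g ∂cn ≤ ∫ _, 1 ∂cn :=
        integral_mono D.integrable_condErrorNoInterference (integrable_const 1)
          D.condErrorNoInterference_le_one
    _ = 1 := by simp

theorem error_le_one (D : StrippingDecoder m ρ α A B) : D.error ≤ 1 :=
  calc D.error ≤ ∫ _, 1 ∂(cn.prod cn) :=
        integral_mono D.integrable_condError (integrable_const 1) fun h =>
          D.condError_le_one h.1 h.2
    _ = 1 := by simp

theorem le_condErrorNoInterference (D : StrippingDecoder m ρ α A B) (hρ : 0 ≤ ρ)
    (hA : ∀ a ∈ A, ‖a‖ ≤ 1) (hcard : 2 ≤ A.card) {g : ℂ} (hg : ρ * ‖g‖ ^ 2 ≤ A.card / 400) :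
    1 / 50 ≤ D.condErrorNoInterference g :=
  one_div_fifty_le_symbolError hA hcard (by rwa [norm_sqrt_mul_sq hρ])
    (D.measurable_intended.comp measurable_prodMk_left)

theorem le_condError (D : StrippingDecoder m ρ α A B) (hρ : 0 ≤ ρ) (hA : ∀ a ∈ A, ‖a‖ ≤ 1)
    (hcard : 2 ≤ A.card) {g : ℂ} (hg : ρ * ‖g‖ ^ 2 ≤ A.card / 400) (k : ℂ) :
    1 / 50 ≤ D.condError g k := by
  rw [condError_eq_expect]
  refine Finset.le_expect D.nonempty_interferer fun b _ =>
    one_div_fifty_le_symbolError hA hcard (by rwa [norm_sqrt_mul_sq hρ]) ?_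
  exact D.measurable_output.comp
    (f := fun y => (g, k, y + (√(ρ ^ α) : ℂ) * k * b)) (by fun_prop)

theorem le_errorNoInterference (D : StrippingDecoder m ρ α A B) (hρ : 0 < ρ)
    (hA : ∀ a ∈ A, ‖a‖ ≤ 1) (hcard : 2 ≤ A.card) :
    min 1 (A.card / ρ) / 40000 ≤ D.errorNoInterference := by
  rw [errorNoInterference_eq_integral]
  exact min_one_div_le_integral_cn D.integrable_condErrorNoInterference
    D.condErrorNoInterference_nonneg hρ (by positivity)
    fun g => D.le_condErrorNoInterference hρ.le hA hcard

theorem le_error (D : StrippingDecoder m ρ α A B) (hρ : 0 < ρ)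
    (hA : ∀ a ∈ A, ‖a‖ ≤ 1) (hcard : 2 ≤ A.card) :
    min 1 (A.card / ρ) / 40000 ≤ D.error := by
  have hsection (g : ℂ) : Integrable (D.condError g) cn :=
    .of_bound (D.measurable_condError.comp measurable_prodMk_left).aestronglyMeasurable 1 <|
      Eventually.of_forall fun k => by
        rw [Real.norm_of_nonneg (D.condError_nonneg g k)]
        exact D.condError_le_one g k
  rw [error, integral_prod _ D.integrable_condError]
  refine min_one_div_le_integral_cn D.integrable_condError.integral_prod_left
    (fun g => integral_nonneg (D.condError_nonneg g)) hρ (by positivity) fun g hg => ?_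
  calc (1 / 50 : ℝ) = ∫ _, 1 / 50 ∂cn := by simp
    _ ≤ ∫ k, D.condError g k ∂cn :=
      integral_mono (integrable_const _) (hsection g) (D.le_condError hρ.le hA hcard hg)

theorem condErrorNoInterference_le (D : StrippingDecoder m ρ α A B) (hρ : 0 ≤ ρ) {Δ : ℝ}
    (hΔ : (A : Set ℂ).Pairwise fun x x' => Δ ≤ ‖x - x'‖ ^ 2) (g : ℂ) :
    D.condErrorNoInterference g ≤ 2 * Real.exp (-(ρ * Δ / 8) * ‖g‖ ^ 2) := by
  refine Finset.expect_le D.nonempty_intended fun a ha => ?_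
  have hnoise : {z | D.intended (g, (√ρ : ℂ) * g * a + z) ≠ a} ⊆
      {z | ρ * Δ / 4 * ‖g‖ ^ 2 ≤ ‖z‖ ^ 2} := by
    intro z hz
    have hml := D.intended_ml g ((√ρ : ℂ) * g * a + z)
    have hnorm := pow_le_pow_left₀ (norm_nonneg _) (hml.norm_mul_sub_le zero_lt_one ha) 2
    rw [add_sub_cancel_left, norm_mul, mul_pow, mul_pow, norm_sqrt_mul_sq hρ] at hnorm
    have hdist := mul_le_mul_of_nonneg_left (hΔ ha hml.1 (Ne.symm hz))
      (by positivity : 0 ≤ ρ * ‖g‖ ^ 2)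
    change ρ * Δ / 4 * ‖g‖ ^ 2 ≤ ‖z‖ ^ 2
    linarith
  calc cn.real {z | D.intended (g, (√ρ : ℂ) * g * a + z) ≠ a}
      ≤ 2 * Real.exp (-(ρ * Δ / 4 * ‖g‖ ^ 2 / 2)) :=
        (measureReal_mono hnoise).trans (cn_real_setOf_le_sq_norm_le _)
    _ = 2 * Real.exp (-(ρ * Δ / 8) * ‖g‖ ^ 2) := by ring_nf

theorem errorNoInterference_le (D : StrippingDecoder m ρ α A B) (hρ : 0 < ρ) {Δ : ℝ} (hΔ₀ : 0 < Δ)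
    (hΔ : (A : Set ℂ).Pairwise fun x x' => Δ ≤ ‖x - x'‖ ^ 2) :
    D.errorNoInterference ≤ 16 / (ρ * Δ) := by
  have hc : 0 < ρ * Δ / 8 := by positivity
  rw [errorNoInterference_eq_integral]
  calc ∫ g, D.condErrorNoInterference g ∂cn
      ≤ ∫ g, 2 * Real.exp (-(ρ * Δ / 8) * ‖g‖ ^ 2) ∂cn :=
        integral_mono D.integrable_condErrorNoInterference
          ((integrable_exp_mul_sq_norm_cn (by linarith)).const_mul 2)
          (D.condErrorNoInterference_le hρ.le hΔ)
    _ ≤ 2 * (ρ * Δ / 8)⁻¹ := by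
        rw [integral_const_mul]
        gcongr
        exact integral_exp_neg_mul_sq_norm_cn_le hc
    _ = 16 / (ρ * Δ) := by field_simp; norm_num

theorem sq_norm_le_of_interferer_ne (D : StrippingDecoder m ρ α A B) (hρ : 1 ≤ ρ)
    (hA : ∀ a ∈ A, ‖a‖ ≤ 1) (hlog : Real.log A.card ≤ ρ) {Δ : ℝ}
    (hΔ : (B : Set ℂ).Pairwise fun x x' => Δ ≤ ‖x - x'‖ ^ 2) {a b g k z : ℂ} (ha : a ∈ A)
    (hb : b ∈ B)
    (hz : D.interferer (g, k, (√ρ : ℂ) * g * a + (√(ρ ^ α) : ℂ) * k * b + z) ≠ b) :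
    ρ ^ (α - 1) * Δ / 12 * ‖k‖ ^ 2 - ‖g‖ ^ 2 - 1 ≤ ‖z‖ ^ 2 := by
  have hρ₀ : 0 < ρ := by linarith
  have hml := D.interferer_ml g k ((√ρ : ℂ) * g * a + (√(ρ ^ α) : ℂ) * k * b + z)
  have hnorm := hml.sq_norm_mul_sub_le hρ₀.le hA ha hb
  rw [norm_mul, mul_pow, norm_sqrt_mul_sq (Real.rpow_nonneg hρ₀.le α),
    norm_sqrt_mul_sq hρ₀.le] at hnorm
  have hdist := mul_le_mul_of_nonneg_left (hΔ hb hml.1 (Ne.symm hz))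
    (by positivity : 0 ≤ ρ ^ α * ‖k‖ ^ 2)
  have hscale : ρ * (ρ ^ (α - 1) * Δ / 12 * ‖k‖ ^ 2) ≤ ρ * (‖g‖ ^ 2 + ‖z‖ ^ 2 + 1) := by
    rw [Real.rpow_sub_one hρ₀.ne']
    field_simp
    nlinarith [mul_nonneg (sub_nonneg.2 hρ) (sq_nonneg ‖z‖)]
  linarith [le_of_mul_le_mul_left hscale hρ₀]

theorem cn_real_interferer_ne_le (D : StrippingDecoder m ρ α A B) (hρ : 1 ≤ ρ)
    (hA : ∀ a ∈ A, ‖a‖ ≤ 1) (hlog : Real.log A.card ≤ ρ) {Δ : ℝ}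
    (hΔ : (B : Set ℂ).Pairwise fun x x' => Δ ≤ ‖x - x'‖ ^ 2) {a b : ℂ} (ha : a ∈ A) (hb : b ∈ B)
    (g k : ℂ) :
    cn.real {z | D.interferer (g, k, (√ρ : ℂ) * g * a + (√(ρ ^ α) : ℂ) * k * b + z) ≠ b} ≤
      4 * (Real.exp (1 / 2 * ‖g‖ ^ 2) * Real.exp (-(ρ ^ (α - 1) * Δ / 24) * ‖k‖ ^ 2)) := by
  have hhalf : Real.exp (1 / 2) ≤ 2 := by
    rw [← Real.le_log_iff_exp_le two_pos]
    linarith [Real.log_two_gt_d9]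
  calc cn.real {z | D.interferer (g, k, (√ρ : ℂ) * g * a + (√(ρ ^ α) : ℂ) * k * b + z) ≠ b}
      ≤ 2 * Real.exp (-((ρ ^ (α - 1) * Δ / 12 * ‖k‖ ^ 2 - ‖g‖ ^ 2 - 1) / 2)) :=
        (measureReal_mono fun z hz => D.sq_norm_le_of_interferer_ne hρ hA hlog hΔ ha hb hz).trans
          (cn_real_setOf_le_sq_norm_le _)
    _ = 2 * Real.exp (1 / 2) *
          (Real.exp (1 / 2 * ‖g‖ ^ 2) * Real.exp (-(ρ ^ (α - 1) * Δ / 24) * ‖k‖ ^ 2)) := by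
        rw [mul_assoc, ← Real.exp_add, ← Real.exp_add]
        ring_nf
    _ ≤ 4 * (Real.exp (1 / 2 * ‖g‖ ^ 2) * Real.exp (-(ρ ^ (α - 1) * Δ / 24) * ‖k‖ ^ 2)) := by
        gcongr
        linarith

theorem condError_le_condErrorNoInterference_add (D : StrippingDecoder m ρ α A B) {g k : ℂ} {q : ℝ}
    (h : ∀ a ∈ A, ∀ b ∈ B,
      cn.real {z | D.interferer (g, k, (√ρ : ℂ) * g * a + (√(ρ ^ α) : ℂ) * k * b + z) ≠ b} ≤ q) :
    D.condError g k ≤ D.condErrorNoInterference g + q := by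
  rw [condError_eq_expect]
  refine Finset.expect_le D.nonempty_interferer fun b hb =>
    symbolError_le_add D.nonempty_intended fun a ha => ?_
  refine (measureReal_mono fun z => mt fun hdec => ?_).trans (h a ha b hb)
  rw [add_right_comm] at hdec
  rw [output, hdec, add_sub_cancel_right]

theorem error_le (D : StrippingDecoder m ρ α A B) (hρ : 1 ≤ ρ) (hA : ∀ a ∈ A, ‖a‖ ≤ 1)
    (hlog : Real.log A.card ≤ ρ) {Δ : ℝ} (hΔ₀ : 0 < Δ)
    (hΔ : (B : Set ℂ).Pairwise fun x x' => Δ ≤ ‖x - x'‖ ^ 2) :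
    D.error ≤ D.errorNoInterference + 192 / (ρ ^ (α - 1) * Δ) := by
  set c := ρ ^ (α - 1) * Δ / 24 with hc_def
  have hc : 0 < c := by
    have : 0 < ρ := by linarith
    positivity
  have hint₁ : Integrable (fun h : ℂ × ℂ => D.condErrorNoInterference h.1) (cn.prod cn) :=
    D.integrable_condErrorNoInterference.comp_fst cn
  have hint₂ : Integrable (fun h : ℂ × ℂ =>
      4 * (Real.exp (1 / 2 * ‖h.1‖ ^ 2) * Real.exp (-c * ‖h.2‖ ^ 2))) (cn.prod cn) :=
    ((integrable_exp_mul_sq_norm_cn one_half_lt_one).mul_prod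
      (integrable_exp_mul_sq_norm_cn (by linarith))).const_mul 4
  have hhalf : ∫ g, Real.exp (1 / 2 * ‖g‖ ^ 2) ∂cn = 2 :=
    (mgf_sq_norm_cn one_half_lt_one).trans (by norm_num)
  calc D.error
      ≤ ∫ h : ℂ × ℂ, (D.condErrorNoInterference h.1 +
          4 * (Real.exp (1 / 2 * ‖h.1‖ ^ 2) * Real.exp (-c * ‖h.2‖ ^ 2))) ∂(cn.prod cn) :=
        integral_mono D.integrable_condError (hint₁.add hint₂) fun h =>
          D.condError_le_condErrorNoInterference_add fun a ha b hb =>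
            D.cn_real_interferer_ne_le hρ hA hlog hΔ ha hb h.1 h.2
    _ = D.errorNoInterference + 4 * (2 * ∫ k, Real.exp (-c * ‖k‖ ^ 2) ∂cn) := by
        rw [integral_add hint₁ hint₂, integral_fun_fst D.condErrorNoInterference,
          integral_const_mul, integral_prod_mul (fun g : ℂ => Real.exp (1 / 2 * ‖g‖ ^ 2))
            (fun k : ℂ => Real.exp (-c * ‖k‖ ^ 2)), hhalf, probReal_univ, one_smul,
          ← errorNoInterference_eq_integral]
    _ ≤ D.errorNoInterference + 4 * (2 * c⁻¹) := by
        gcongr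
        exact integral_exp_neg_mul_sq_norm_cn_le hc
    _ = D.errorNoInterference + 192 / (ρ ^ (α - 1) * Δ) := by
        rw [hc_def, inv_div]
        ring

end StrippingDecoder

/-! ### Exponential orders -/

/-- The exponential inequality `f ρ ≤̇ ρ ^ x` for `ρ → ∞`, in terms of `f` rather than of its
logarithm so that it is meaningful also where `f` vanishes. -/
def ExpLe (f : ℝ → ℝ) (x : ℝ) : Prop :=
  ∀ δ > 0, ∀ᶠ ρ in atTop, f ρ ≤ ρ ^ (x + δ)

/-- The exponential inequality `f ρ ≥̇ ρ ^ x` for `ρ → ∞`, the counterpart of `ExpLe`. -/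
def ExpGe (f : ℝ → ℝ) (x : ℝ) : Prop :=
  ∀ δ > 0, ∀ᶠ ρ in atTop, ρ ^ (x - δ) ≤ f ρ

theorem ExpGe.eventually_pos {f : ℝ → ℝ} {x : ℝ} (h : ExpGe f x) : ∀ᶠ ρ in atTop, 0 < f ρ := by
  filter_upwards [h 1 one_pos, eventually_gt_atTop 0] with ρ hf hρ
  exact (Real.rpow_pos_of_pos hρ _).trans_le hf

theorem tendsto_logb_iff_expGe_and_expLe {f : ℝ → ℝ} {x : ℝ} (hf : ∀ᶠ ρ in atTop, 0 < f ρ) :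
    Tendsto (fun ρ => Real.logb ρ (f ρ)) atTop (𝓝 x) ↔ ExpGe f x ∧ ExpLe f x := by
  rw [tendsto_order]
  refine and_congr ⟨fun h δ hδ => ?_, fun h y hy => ?_⟩ ⟨fun h δ hδ => ?_, fun h y hy => ?_⟩
  · filter_upwards [h (x - δ) (by linarith), hf, eventually_gt_atTop 1] with ρ hlog hpos hρ
    exact (Real.le_logb_iff_rpow_le hρ hpos).1 hlog.le
  · filter_upwards [h ((x - y) / 2) (by linarith), hf, eventually_gt_atTop 1] with ρ hle hpos hρ
    linarith [(Real.le_logb_iff_rpow_le hρ hpos).2 hle]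
  · filter_upwards [h (x + δ) (by linarith), hf, eventually_gt_atTop 1] with ρ hlog hpos hρ
    exact (Real.logb_le_iff_le_rpow hρ hpos).1 hlog.le
  · filter_upwards [h ((y - x) / 2) (by linarith), hf, eventually_gt_atTop 1] with ρ hle hpos hρ
    linarith [(Real.logb_le_iff_le_rpow hρ hpos).2 hle]

theorem expEq_rpow_iff {f : ℝ → ℝ} {x : ℝ} :
    ExpEq f (fun ρ => ρ ^ x) ↔ ExpGe f x ∧ ExpLe f x := by
  have hpow : Tendsto (fun ρ : ℝ => Real.logb ρ (ρ ^ x)) atTop (𝓝 x) := by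
    refine tendsto_const_nhds.congr' ?_
    filter_upwards [eventually_gt_atTop 1] with ρ hρ
    rw [Real.logb_rpow (by linarith) hρ.ne']
  constructor
  · rintro ⟨hf, -, c, hfc, hc⟩
    obtain rfl : c = x := tendsto_nhds_unique hc hpow
    exact (tendsto_logb_iff_expGe_and_expLe hf).1 hfc
  · intro h
    have hf := h.1.eventually_pos
    refine ⟨hf, ?_, x, (tendsto_logb_iff_expGe_and_expLe hf).2 h, hpow⟩
    filter_upwards [eventually_gt_atTop 0] with ρ hρ using Real.rpow_pos_of_pos hρ x

namespace ExpLe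

variable {f g : ℝ → ℝ} {x y : ℝ}

theorem mono (h : ExpLe f x) (hxy : x ≤ y) : ExpLe f y := fun δ hδ => by
  filter_upwards [h δ hδ, eventually_ge_atTop 1] with ρ hf hρ
  exact hf.trans (by gcongr)

protected theorem max (hf : ExpLe f x) (hg : ExpLe g x) :
    ExpLe (fun ρ => max (f ρ) (g ρ)) x := fun δ hδ => by
  filter_upwards [hf δ hδ, hg δ hδ] with ρ using max_le

theorem min_zero (h : ExpLe f x) (hf : ∀ ρ, f ρ ≤ 1) : ExpLe f (min x 0) := fun δ hδ => by
  filter_upwards [h δ hδ, eventually_ge_atTop 1] with ρ hx hρ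
  rcases min_choice x 0 with hmin | hmin <;> rw [hmin]
  · exact hx
  · exact (hf ρ).trans (Real.one_le_rpow hρ (by linarith))

theorem of_le_const_mul {c : ℝ} (h : ∀ δ > 0, ∀ᶠ ρ in atTop, f ρ ≤ c * ρ ^ (x + δ)) :
    ExpLe f x := fun δ hδ => by
  filter_upwards [h (δ / 2) (by linarith), eventually_gt_atTop 0,
    (tendsto_rpow_atTop (half_pos hδ)).eventually_ge_atTop c] with ρ hf hρ hc
  calc f ρ ≤ c * ρ ^ (x + δ / 2) := hf
    _ ≤ ρ ^ (δ / 2) * ρ ^ (x + δ / 2) := by gcongr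
    _ = ρ ^ (x + δ) := by rw [← Real.rpow_add hρ]; ring_nf

end ExpLe

namespace ExpGe

variable {f g : ℝ → ℝ} {x y : ℝ}

protected theorem max (hf : ExpGe f x) (hg : ExpGe g y) :
    ExpGe (fun ρ => max (f ρ) (g ρ)) (max x y) := fun δ hδ => by
  filter_upwards [hf δ hδ, hg δ hδ] with ρ hx hy
  rcases max_choice x y with hmax | hmax <;> rw [hmax]
  · exact hx.trans (le_max_left _ _)
  · exact hy.trans (le_max_right _ _)

theorem min_one_div (hf : ExpGe f x) :
    ExpGe (fun ρ => min 1 (f ρ / ρ)) (min (x - 1) 0) := fun δ hδ => by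
  filter_upwards [hf δ hδ, eventually_ge_atTop 1] with ρ hx hρ
  refine le_min (Real.rpow_le_one_of_one_le_of_nonpos hρ (by linarith [min_le_right (x - 1) 0])) ?_
  calc ρ ^ (min (x - 1) 0 - δ) ≤ ρ ^ (x - δ - 1) :=
        Real.rpow_le_rpow_of_exponent_le hρ (by linarith [min_le_left (x - 1) 0])
    _ ≤ f ρ / ρ := by
        rw [Real.rpow_sub_one (by linarith)]
        gcongr

theorem of_const_mul_le {c : ℝ} (hf : ExpGe f x) (hc : 0 < c) (h : ∀ᶠ ρ in atTop, c * f ρ ≤ g ρ) :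
    ExpGe g x := fun δ hδ => by
  filter_upwards [hf (δ / 2) (half_pos hδ), h, eventually_gt_atTop 0,
    (tendsto_rpow_atTop (half_pos hδ)).eventually_ge_atTop c⁻¹] with ρ hx hle hρ hlarge
  calc ρ ^ (x - δ) = 1 * ρ ^ (x - δ) := (one_mul _).symm
    _ ≤ c * ρ ^ (δ / 2) * ρ ^ (x - δ) := by
        gcongr
        exact (inv_le_iff_one_le_mul₀' hc).1 hlarge
    _ = c * ρ ^ (x - δ / 2) := by
        rw [mul_assoc, ← Real.rpow_add hρ]
        ring_nf
    _ ≤ g ρ := le_trans (by gcongr) hle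

end ExpGe

/-! ### Codebook families and diversity orders -/

namespace MinDistExpGe

variable {C : ℝ → Finset ℂ} {s t : ℝ}

theorem mono (h : MinDistExpGe C t) (hst : s ≤ t) : MinDistExpGe C s := fun δ hδ => by
  filter_upwards [h δ hδ, eventually_ge_atTop 1] with ρ hC hρ x hx x' hx' hne
  exact le_trans (by gcongr) (hC x hx x' hx' hne)

theorem eventually_pairwise (h : MinDistExpGe C s) {δ : ℝ} (hδ : 0 < δ) :
    ∀ᶠ ρ in atTop, (C ρ : Set ℂ).Pairwise fun x x' => ρ ^ (s - δ) ≤ ‖x - x'‖ ^ 2 := by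
  filter_upwards [h δ hδ] with ρ hC x hx x' hx' using hC x hx x' hx'

end MinDistExpGe

namespace IsCodebookFamily

variable {C : ℝ → Finset ℂ} {r : ℝ}

theorem norm_le_one (hC : IsCodebookFamily r C) (ρ : ℝ) : ∀ x ∈ C ρ, ‖x‖ ≤ 1 := fun x hx =>
  (sq_le_one_iff₀ (norm_nonneg x)).1 (hC.power ρ x hx)

theorem expGe_card (hC : IsCodebookFamily r C) : ExpGe (fun ρ => ((C ρ).card : ℝ)) r :=
  (expEq_rpow_iff.1 hC.card).1

theorem eventually_log_card_le (hC : IsCodebookFamily r C) :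
    ∀ᶠ ρ in atTop, Real.log (C ρ).card ≤ ρ := by
  filter_upwards [(expEq_rpow_iff.1 hC.card).2 1 one_pos,
    (isLittleO_rpow_exp_atTop (r + 1)).eventuallyLE, eventually_ge_atTop 0] with ρ hcard hexp hρ
  rw [Real.norm_of_nonneg (Real.rpow_nonneg hρ _), Real.norm_of_nonneg (Real.exp_pos ρ).le] at hexp
  exact (Real.log_le_iff_le_exp (by exact_mod_cast (hC.nonempty ρ).card_pos)).2 (hcard.trans hexp)

end IsCodebookFamily

variable {m : NoiseModel} {α r r' : ℝ} {C C' : ℝ → Finset ℂ}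

theorem const_div_rpow_mul_rpow {ρ : ℝ} (hρ : 0 < ρ) (c x y : ℝ) :
    c / (ρ ^ x * ρ ^ y) = c * ρ ^ (-x - y) := by
  rw [← Real.rpow_add hρ, div_eq_mul_inv, ← Real.rpow_neg hρ.le, neg_add']

theorem expLe_errorNoInterference (hΔ : MinDistExpGe C (-r))
    (D : ∀ ρ, StrippingDecoder m ρ α (C ρ) (C' ρ)) :
    ExpLe (fun ρ => (D ρ).errorNoInterference) (min (r - 1) 0) := by
  refine ExpLe.min_zero (.of_le_const_mul (c := 16) fun δ hδ => ?_)
    fun ρ => (D ρ).errorNoInterference_le_one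
  filter_upwards [hΔ.eventually_pairwise hδ, eventually_gt_atTop 0] with ρ hdist hρ
  calc (D ρ).errorNoInterference ≤ 16 / (ρ ^ (1 : ℝ) * ρ ^ (-r - δ)) := by
        rw [Real.rpow_one]
        exact (D ρ).errorNoInterference_le hρ (Real.rpow_pos_of_pos hρ _) hdist
    _ = 16 * ρ ^ (r - 1 + δ) := by
        rw [const_div_rpow_mul_rpow hρ]
        ring_nf

theorem expLe_error (hC : IsCodebookFamily r C) (hΔ : MinDistExpGe C (-r))
    (hΔ' : MinDistExpGe C' (-r')) (D : ∀ ρ, StrippingDecoder m ρ α (C ρ) (C' ρ)) :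
    ExpLe (fun ρ => (D ρ).error) (min (max (r - 1) (r' + 1 - α)) 0) := by
  refine ExpLe.min_zero (.of_le_const_mul (c := 193) fun δ hδ => ?_) fun ρ => (D ρ).error_le_one
  filter_upwards [(expLe_errorNoInterference hΔ D).mono (min_le_left _ _) δ hδ,
    hΔ'.eventually_pairwise hδ, hC.eventually_log_card_le, eventually_ge_atTop 1]
    with ρ hintended hdist hlog hρ
  have hρ₀ : 0 < ρ := by linarith
  calc (D ρ).error
      ≤ (D ρ).errorNoInterference + 192 / (ρ ^ (α - 1) * ρ ^ (-r' - δ)) :=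
        (D ρ).error_le hρ (hC.norm_le_one ρ) hlog (Real.rpow_pos_of_pos hρ₀ _) hdist
    _ ≤ ρ ^ (r - 1 + δ) + 192 * ρ ^ (r' + 1 - α + δ) := by
        rw [const_div_rpow_mul_rpow hρ₀,
          show -(α - 1) - (-r' - δ) = r' + 1 - α + δ by ring]
        gcongr
    _ ≤ ρ ^ (max (r - 1) (r' + 1 - α) + δ) + 192 * ρ ^ (max (r - 1) (r' + 1 - α) + δ) := by
        gcongr
        exacts [le_max_left _ _, le_max_right _ _]
    _ = 193 * ρ ^ (max (r - 1) (r' + 1 - α) + δ) := by ring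

theorem apply_max_le_max_of_le {ι β : Type*} [LinearOrder ι] [LinearOrder β] {f : ι → β}
    {i j k : ι} {p q : β} (h : k ≤ i ∨ k ≤ j) (hp : k ≤ i → f i ≤ p) (hq : k ≤ j → f j ≤ q) :
    f (max i j) ≤ max p q := by
  rcases le_total i j with hij | hij
  · rw [max_eq_right hij]
    exact (hq (h.elim (·.trans hij) id)).trans (le_max_right p q)
  · rw [max_eq_left hij]
    exact (hp (h.elim id (·.trans hij))).trans (le_max_left p q)

theorem expGe_max_of_min_one_card_div_le (hC : IsCodebookFamily r C) (hC' : IsCodebookFamily r' C')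
    (hcard : ∀ᶠ ρ in atTop, 2 ≤ (C ρ).card ∨ 2 ≤ (C' ρ).card) {P P' : ℝ → ℝ}
    (hP : ∀ ρ > 0, 2 ≤ (C ρ).card → min 1 ((C ρ).card / ρ) / 40000 ≤ P ρ)
    (hP' : ∀ ρ > 0, 2 ≤ (C' ρ).card → min 1 ((C' ρ).card / ρ) / 40000 ≤ P' ρ) :
    ExpGe (fun ρ => max (P ρ) (P' ρ)) (min (max r r' - 1) 0) := by
  refine (hC.expGe_card.max hC'.expGe_card).min_one_div.of_const_mul_le
    (c := 1 / 40000) (by norm_num) ?_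
  filter_upwards [hcard, eventually_gt_atTop 0] with ρ hcard hρ
  have hlarger := apply_max_le_max_of_le (f := fun N : ℕ => min 1 (N / ρ) / 40000) hcard
    (hP ρ hρ) (hP' ρ hρ)
  rwa [Nat.cast_max, div_eq_inv_mul, ← one_div] at hlarger

end FadingIC

theorem theorem1_general {α r₁ r₂ : ℝ} (hα : 2 ≤ α) {C₁ C₂ : ℝ → Finset ℂ}
    (hC₁ : IsCodebookFamily r₁ C₁) (hC₂ : IsCodebookFamily r₂ C₂)
    (hC : ∀ᶠ ρ in atTop, 2 ≤ (C₁ ρ).card ∨ 2 ≤ (C₂ ρ).card)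
    (hΔ₁ : MinDistExpGe C₁ (-r₁)) (hΔ₂ : MinDistExpGe C₂ (-r₂)) {m : NoiseModel}
    (D₁ : ∀ ρ, StrippingDecoder m ρ α (C₁ ρ) (C₂ ρ))
    (D₂ : ∀ ρ, StrippingDecoder m ρ α (C₂ ρ) (C₁ ρ)) :
    ExpEq (fun ρ => max (D₁ ρ).error (D₂ ρ).error)
        (fun ρ => ρ ^ (-min (max (1 - r₁) 0) (max (1 - r₂) 0))) ∧
      ExpEq (fun ρ => max (D₁ ρ).errorNoInterference (D₂ ρ).errorNoInterference)
        (fun ρ => ρ ^ (-min (max (1 - r₁) 0) (max (1 - r₂) 0))) := by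
  have hexponent : -min (max (1 - r₁) 0) (max (1 - r₂) 0) = min (max r₁ r₂ - 1) 0 := by grind
  have hmax₁ := le_max_left r₁ r₂
  have hmax₂ := le_max_right r₁ r₂
  simp only [hexponent, expEq_rpow_iff]
  refine ⟨⟨?_, .max ?_ ?_⟩, ?_, .max ?_ ?_⟩
  · exact expGe_max_of_min_one_card_div_le hC₁ hC₂ hC
      (fun ρ hρ => (D₁ ρ).le_error hρ (hC₁.norm_le_one ρ))
      (fun ρ hρ => (D₂ ρ).le_error hρ (hC₂.norm_le_one ρ))
  · exact (expLe_error hC₁ hΔ₁ hΔ₂ D₁).mono (by gcongr; exact max_le (by linarith) (by linarith))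
  · exact (expLe_error hC₂ hΔ₂ hΔ₁ D₂).mono (by gcongr; exact max_le (by linarith) (by linarith))
  · exact expGe_max_of_min_one_card_div_le hC₁ hC₂ hC
      (fun ρ hρ => (D₁ ρ).le_errorNoInterference hρ (hC₁.norm_le_one ρ))
      (fun ρ hρ => (D₂ ρ).le_errorNoInterference hρ (hC₂.norm_le_one ρ))
  · exact (expLe_errorNoInterference hΔ₁ D₁).mono (by gcongr)
  · exact (expLe_errorNoInterference hΔ₂ D₂).mono (by gcongr)

theorem theorem1 (α r₁ r₂ ε : ℝ) (hα : 2 ≤ α)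
    (hr₁ : 0 ≤ r₁ ∧ r₁ ≤ 1) (hr₂ : 0 ≤ r₂ ∧ r₂ ≤ 1) (hε : 0 ≤ ε)
    (C₁ C₂ : ℝ → Finset ℂ)
    (hC₁ : IsCodebookFamily r₁ C₁) (hC₂ : IsCodebookFamily r₂ C₂)
    (hC : ∀ᶠ ρ in atTop, 2 ≤ (C₁ ρ).card ∨ 2 ≤ (C₂ ρ).card)
    (hΔ₁ : MinDistExpGe C₁ (-r₁ + ε)) (hΔ₂ : MinDistExpGe C₂ (-r₂ + ε))
    (m : NoiseModel)
    (D₁ : ∀ ρ, StrippingDecoder m ρ α (C₁ ρ) (C₂ ρ))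
    (D₂ : ∀ ρ, StrippingDecoder m ρ α (C₂ ρ) (C₁ ρ)) :
    ExpEq (fun ρ => max (D₁ ρ).error (D₂ ρ).error)
        (fun ρ => ρ ^ (-min (max (1 - r₁) 0) (max (1 - r₂) 0))) ∧
      ExpEq (fun ρ => max (D₁ ρ).errorNoInterference (D₂ ρ).errorNoInterference)
        (fun ρ => ρ ^ (-min (max (1 - r₁) 0) (max (1 - r₂) 0))) :=
  theorem1_general hα hC₁ hC₂ hC (hΔ₁.mono (by linarith)) (hΔ₂.mono (by linarith)) D₁ D₂
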